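/- Let $(\Omega,\mathcal F,\mathbb P)$ be a probability space with a measurable, measure-preserving, ergodic action $(\tau_x)_{x\in\mathbb R^N}$ of $\mathbb R^N$ (that is, $\tau_0=\mathrm{id}$, $\tau_{x+y}=\tau_x\circ\tau_y$, $(x,\omega)\mapsto\tau_x\omega$ is jointly measurable, each $\tau_x$ preserves $\mathbb P$, and every $A\in\mathcal F$ with $\mathbb P(\tau_xA\,\Delta\,A)=0$ for all $x$ has probability $0$ or $1$). Let $H:\mathbb R^N\times\mathbb R^N\times\Omega\to\mathbb R$ satisfy: (H1) $\omega\mapsto H(\cdot,\cdot,\omega)$ is a random variable with values in $C(\mathbb R^N\times\mathbb R^N)$ with the topology of locally uniform convergence; (H2) $H(x,\cdot,\omega)$ is convex for all $(x,\omega)$; (H3) there are superlinear $\alpha,\beta:[0,\infty)\to\mathbb R$ with $\alpha(|p|)\le H(x,p,\omega)\le\beta(|p|)$ for all $(x,p,\omega)$; (H4) for all $(x,\omega)$ the set of minimizers of $H(x,\cdot,\omega)$ has empty interior; (H5) $H(\cdot+z,\cdot,\omega)=H(\cdot,\cdot,\tau_z\omega)$ for all $(z,\omega)$. A Lipschitz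 random function is a random variable $\omega\mapsto v(\cdot,\omega)$ with values in the space of $\kappa$-Lipschitz real functions on $\mathbb R^N$ (topology of locally uniform convergence) for some $\kappa$ independent of $\omega$. It is admissible if it has stationary increments (for every $z$, almost surely, $v(x+z,\omega)-v(y+z,\omega)=v(x,\tau_z\omega)-v(y,\tau_z\omega)$ for all $x,y$) and its gradient has mean zero ($\mathbb E(Dv(x,\cdot))=0$ for every $x$). For $a\in\mathbb R$ let $\mathcal S_a$ be the set of admissible $v$ such that, almost surely in $\omega$, $H(x,Dv(x,\omega),\omega)\le a$ for a.e. $x\in\mathbb R^N$. Theorem. (i) Let $(a_n)_n$ be a sequence of real numbers converging to some $a\in\mathbb R$, and let $v_n\in\mathcal S_{a_n}$ for each $n$. Then there exist $v\in\mathcal S_a$, indices $m_k\to\infty$, finite convex combinations $w_k=\sum_{n\ge m_k}\lambda^k_n v_n$ and real random variables $g_k$ such that, almost surely in $\omega$, $w_k(\cdot,\omega)+g_k(\omega)\to v(\cdot,\omega)$ uniformly on compact subsets of $\mathbb R^N$. (ii) The set $\{a\in\mathbb R:\mathcal S_a\ne\emptyset\}$ is nonempty and bounded below, and its infimum $c$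 (the critical value) satisfies $\mathcal S_c\neq\emptyset$; that is, the critical equation $H(x,Dv,\omega)=c$ has admissible subsolutions. -/

import Mathlib

open MeasureTheory Filter Topology
open scoped NNReal

namespace StochasticHJ

/-- Euclidean space of dimension `N`. -/
abbrev Space (N : ℕ) : Type := EuclideanSpace ℝ (Fin N)

/-- A function on `[0, ∞)` (only its values there matter) is superlinear if `α h / h → +∞`
as `h → +∞`. -/
def Superlinear (α : ℝ → ℝ) : Prop :=
  Tendsto (fun h : ℝ => α h / h) atTop atTop

/-- The standing assumptions on a stationary random Hamiltonian, with `H(x, p, ω)` written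
`H ω (x, p)`; the dynamical system `τ_z ω` is the additive action `z +ᵥ ω`. The space
`C(Space N × Space N, ℝ)` carries the topology of locally uniform convergence and its Borel
sigma-algebra. -/
structure IsStationaryHamiltonian {N : ℕ} {Ω : Type*} [MeasurableSpace Ω]
    [AddAction (Space N) Ω] (H : Ω → C(Space N × Space N, ℝ)) : Prop where
  measurable : Measurable[_, borel C(Space N × Space N, ℝ)] H
  convex : ∀ (x : Space N) (ω : Ω), ConvexOn ℝ Set.univ (fun p : Space N => H ω (x, p))
  growth : ∃ α β : ℝ → ℝ, Superlinear α ∧ Superlinear β ∧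
    ∀ (x p : Space N) (ω : Ω), α ‖p‖ ≤ H ω (x, p) ∧ H ω (x, p) ≤ β ‖p‖
  minimizers : ∀ (x : Space N) (ω : Ω),
    interior {p : Space N | ∀ q : Space N, H ω (x, p) ≤ H ω (x, q)} = ∅
  stationary : ∀ (z : Space N) (ω : Ω) (x p : Space N), H ω (x + z, p) = H (z +ᵥ ω) (x, p)

/-- A Lipschitz random function: a random variable with values in the space of
`κ`-Lipschitz functions, for some `κ` independent of `ω`, with the topology of locally uniform
convergence and its Borel sigma-algebra. -/
def IsLipschitzRandomFunction {N : ℕ} {Ω : Type*} [MeasurableSpace Ω]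
    (v : Ω → C(Space N, ℝ)) : Prop :=
  Measurable[_, borel C(Space N, ℝ)] v ∧ ∃ κ : ℝ≥0, ∀ ω : Ω, LipschitzWith κ (v ω)

/-- Stationary increments: for every `z`, almost surely,
`v(x + z, ω) - v(y + z, ω) = v(x, τ_z ω) - v(y, τ_z ω)` for all `x`, `y`. -/
def HasStationaryIncrements {N : ℕ} {Ω : Type*} [MeasurableSpace Ω] [AddAction (Space N) Ω]
    (P : Measure Ω) (v : Ω → C(Space N, ℝ)) : Prop :=
  ∀ z : Space N, ∀ᵐ ω ∂P, ∀ x y : Space N,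
    v ω (x + z) - v ω (y + z) = v (z +ᵥ ω) x - v (z +ᵥ ω) y

/-- The gradient has mean zero: `E(Dv(x, ·)) = 0` for every `x`. For a Lipschitz random function
with stationary increments (the only case in which this is used) and every fixed `x`, the
function `v(·, ω)` is almost surely differentiable at `x`, and `ω ↦ Dv(x, ω)` is measurable and
bounded by the Lipschitz constant, so that the integral is a genuine expectation. -/
def HasMeanZeroGradient {N : ℕ} {Ω : Type*} [MeasurableSpace Ω]
    (P : Measure Ω) (v : Ω → C(Space N, ℝ)) : Prop :=
  ∀ x : Space N, ∫ ω, gradient (v ω) x ∂P = 0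

/-- Admissible random functions: Lipschitz random functions with stationary increments and
gradient of mean zero. -/
structure IsAdmissible {N : ℕ} {Ω : Type*} [MeasurableSpace Ω] [AddAction (Space N) Ω]
    (P : Measure Ω) (v : Ω → C(Space N, ℝ)) : Prop where
  lipschitz : IsLipschitzRandomFunction v
  stationaryIncrements : HasStationaryIncrements P v
  meanZeroGradient : HasMeanZeroGradient P v

/-- Almost surely, `v(·, ω)` is an almost everywhere subsolution of `H(x, Dv, ω) = a`. -/
def IsSubsolution {N : ℕ} {Ω : Type*} [MeasurableSpace Ω]
    (P : Measure Ω) (H : Ω → C(Space N × Space N, ℝ)) (a : ℝ) (v : Ω → C(Space N, ℝ)) : Prop :=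
  ∀ᵐ ω ∂P, ∀ᵐ x ∂(volume : Measure (Space N)),
    DifferentiableAt ℝ (v ω) x ∧ H ω (x, gradient (v ω) x) ≤ a

/-- The class of admissible subsolutions of `H(x, Dv, ω) = a`. -/
def admissibleSubsolutions {N : ℕ} {Ω : Type*} [MeasurableSpace Ω] [AddAction (Space N) Ω]
    (P : Measure Ω) (H : Ω → C(Space N × Space N, ℝ)) (a : ℝ) : Set (Ω → C(Space N, ℝ)) :=
  {v | IsAdmissible P v ∧ IsSubsolution P H a v}

/-- The levels at which the equation has an admissible subsolution. -/
def admissibleLevels {N : ℕ} {Ω : Type*} [MeasurableSpace Ω] [AddAction (Space N) Ω]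
    (P : Measure Ω) (H : Ω → C(Space N × Space N, ℝ)) : Set ℝ :=
  {a | (admissibleSubsolutions P H a).Nonempty}

/-- The stationary critical value: the infimum of the levels at which the equation has an
admissible subsolution. -/
noncomputable def criticalValue {N : ℕ} {Ω : Type*} [MeasurableSpace Ω] [AddAction (Space N) Ω]
    (P : Measure Ω) (H : Ω → C(Space N × Space N, ℝ)) : ℝ :=
  sInf (admissibleLevels P H)

end StochasticHJ

namespace StochasticHJ

/-! By stationarity, the single random vector `gradient (v ω) 0` carries all the relevant
information on `v`: being a subsolution means `H ω (0, gradient (v ω) 0) ≤ a` almost surely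
(`isSubsolution_iff`), and having mean zero gradient is one vanishing expectation
(`hasMeanZeroGradient_iff`). Both conditions are stable under convex combinations.

Coercivity of `H` bounds these vectors uniformly, hence in L². Convex combinations of tails then
converge in norm (`exists_tailWeights_tendsto`) and, along a subsequence, almost surely to some `Φ`.
Integrating along lines recovers the functions from their gradients (`ae_tendsto_line`). With a
common Lipschitz constant, this gives locally uniform convergence of the combinations normalized at
the origin (`exists_limit_randomFunction`). Lebesgue differentiation shows that the limit has
gradient `Φ` (`ae_gradient_limit_eq`), so the constraints pass to the limit.

For (ii), the stability result is applied to levels decreasing to the infimum. The zero function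
provides one level, and a lower bound for `H` bounds all levels below. -/

/-- The Borel sigma-algebra of the topology of locally uniform convergence. -/
abbrev borelContinuousMap (X : Type*) [TopologicalSpace X] : MeasurableSpace C(X, ℝ) :=
  borel C(X, ℝ)

attribute [local instance] borelContinuousMap

theorem borelSpace_continuousMap (X : Type*) [TopologicalSpace X] : BorelSpace C(X, ℝ) := ⟨rfl⟩

attribute [local instance] borelSpace_continuousMap

/-! ### Fubini transfer between the origin and translated points -/

section Transfer

variable {N : ℕ} {Ω : Type*} [MeasurableSpace Ω] [AddAction (Space N) Ω]
  [MeasurableVAdd₂ (Space N) Ω] {P : Measure Ω} [IsProbabilityMeasure P]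
  [VAddInvariantMeasure (Space N) Ω P]

omit [IsProbabilityMeasure P] in
/-- An almost sure property is almost surely satisfied at the image by a fixed translation. -/
theorem ae_vadd {p : Ω → Prop} (h : ∀ᵐ ω ∂P, p ω) (z : Space N) : ∀ᵐ ω ∂P, p (z +ᵥ ω) :=
  (measurePreserving_vadd z P).quasiMeasurePreserving.ae h

omit [IsProbabilityMeasure P] in
theorem ae_vadd_iff {p : Ω → Prop} (z : Space N) : (∀ᵐ ω ∂P, p (z +ᵥ ω)) ↔ ∀ᵐ ω ∂P, p ω := by
  refine ⟨fun h => ?_, fun h => ae_vadd h z⟩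
  filter_upwards [ae_vadd h (-z)] with ω hω
  simpa using hω

variable {T : Type*} [MeasurableSpace T] {μ : Measure T} [SFinite μ]

/-- A measurable property `p` holds almost surely if and only if almost surely it holds along
almost every point of a measurable family of translations. -/
theorem ae_ae_vadd_iff [NeZero μ] {φ : T → Space N} (hφ : Measurable φ) {p : Ω → Prop}
    (hp : MeasurableSet {ω | p ω}) :
    (∀ᵐ ω ∂P, ∀ᵐ t ∂μ, p (φ t +ᵥ ω)) ↔ ∀ᵐ ω ∂P, p ω := by
  have hm : Measurable fun q : Ω × T => φ q.2 +ᵥ q.1 :=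
    (hφ.comp measurable_snd).vadd measurable_fst
  rw [Measure.ae_ae_comm (p := fun ω t => p (φ t +ᵥ ω)) (hm hp)]
  simp_rw [ae_vadd_iff]
  simp

theorem ae_ae_vadd {φ : T → Space N} (hφ : Measurable φ) {p : Ω → Prop} (hp : ∀ᵐ ω ∂P, p ω) :
    ∀ᵐ ω ∂P, ∀ᵐ t ∂μ, p (φ t +ᵥ ω) := by
  -- Fubini needs a measurable event, so `p` is replaced by a measurable set of full measure on
  -- which it holds.
  obtain ⟨s, hs, hsm, hsp⟩ := Eventually.exists_measurable_mem hp
  rcases eq_zero_or_neZero μ with rfl | _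
  · simp
  filter_upwards [(ae_ae_vadd_iff (μ := μ) hφ (p := (· ∈ s)) hsm).2 hs] with ω hω
  filter_upwards [hω] with t ht using hsp _ ht

end Transfer

/-! ### Joint measurability of evaluation and gradient -/

section Measurability

variable {N : ℕ} {Ω : Type*} [MeasurableSpace Ω]

theorem measurable_eval {Y : Type*} [TopologicalSpace Y] [LocallyCompactSpace Y]
    [SecondCountableTopology Y] [MeasurableSpace Y] [OpensMeasurableSpace Y] :
    Measurable fun q : C(Y, ℝ) × Y => q.1 q.2 :=
  (ContinuousEval.continuous_eval (F := C(Y, ℝ))).measurable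

theorem measurable_gradient :
    Measurable fun q : C(Space N, ℝ) × Space N => gradient (q.1 : Space N → ℝ) q.2 := by
  have h := measurable_fderiv_with_param ℝ (f := fun (f : C(Space N, ℝ)) (x : Space N) => f x)
    (ContinuousEval.continuous_eval (F := C(Space N, ℝ)))
  exact (InnerProductSpace.toDual ℝ (Space N)).symm.continuous.measurable.comp h

theorem measurableSet_differentiableAt :
    MeasurableSet {q : C(Space N, ℝ) × Space N | DifferentiableAt ℝ (q.1 : Space N → ℝ) q.2} :=
  measurableSet_of_differentiableAt_with_param ℝ
    (f := fun (f : C(Space N, ℝ)) (x : Space N) => f x)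
    (ContinuousEval.continuous_eval (F := C(Space N, ℝ)))

theorem measurable_gradient_zero {v : Ω → C(Space N, ℝ)} (hv : Measurable v) :
    Measurable fun ω => gradient (v ω) 0 :=
  measurable_gradient.comp (hv.prodMk measurable_const)

theorem measurableSet_differentiableAt_zero {v : Ω → C(Space N, ℝ)} (hv : Measurable v) :
    MeasurableSet {ω | DifferentiableAt ℝ (v ω) 0} :=
  (hv.prodMk measurable_const) measurableSet_differentiableAt

theorem measurable_hamiltonian_gradient_zero {H : Ω → C(Space N × Space N, ℝ)} (hH : Measurable H)
    {φ : Ω → Space N} (hφ : Measurable φ) : Measurable fun ω => H ω (0, φ ω) :=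
  measurable_eval.comp (hH.prodMk (measurable_const.prodMk hφ))

end Measurability

/-! ### Gradients and increments -/

section Gradient

variable {N : ℕ} {f g : Space N → ℝ} {z : Space N}

theorem norm_gradient_le_of_lipschitzWith {κ : ℝ≥0} (hf : LipschitzWith κ f) (x : Space N) :
    ‖gradient f x‖ ≤ κ := by
  rw [← (InnerProductSpace.toDual ℝ (Space N)).norm_map, toDual_gradient]
  exact norm_fderiv_le_of_lipschitz ℝ hf

theorem gradient_and_differentiableAt_congr_increments
    (h : ∀ x, f (x + z) - f (0 + z) = g x - g 0) :
    (DifferentiableAt ℝ f z ↔ DifferentiableAt ℝ g 0) ∧ gradient f z = gradient g 0 := by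
  have hg : g = fun x => f (x + z) - (f z - g 0) := by
    funext x
    have := h x
    rw [zero_add] at this
    linarith
  have h1 : fderiv ℝ g 0 = fderiv ℝ f z := by
    rw [hg, fderiv_sub_const, fderiv_comp_add_right, zero_add]
  refine ⟨?_, by rw [gradient, gradient, h1]⟩
  have h2 : DifferentiableAt ℝ (fun x => f (x + z)) 0 ↔ DifferentiableAt ℝ f z := by
    rw [differentiableAt_comp_add_right, zero_add]
  rw [hg, ← h2]
  exact ⟨fun h => h.sub_const _, fun h => by simpa using h.add_const (f z - g 0)⟩

end Gradient

/-! ### Reduction of admissibility and of the subsolution property to the origin -/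

section StationaryIncrements

variable {N : ℕ} {Ω : Type*} [MeasurableSpace Ω] [AddAction (Space N) Ω]
  {P : Measure Ω} {v : Ω → C(Space N, ℝ)}

theorem HasStationaryIncrements.ae_gradient (hv : HasStationaryIncrements P v) (z : Space N) :
    ∀ᵐ ω ∂P, (DifferentiableAt ℝ (v ω) z ↔ DifferentiableAt ℝ (v (z +ᵥ ω)) 0) ∧
      gradient (v ω) z = gradient (v (z +ᵥ ω)) 0 := by
  filter_upwards [hv z] with ω hω
  exact gradient_and_differentiableAt_congr_increments fun x => hω x 0

variable [MeasurableVAdd₂ (Space N) Ω] [IsProbabilityMeasure P]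
  [VAddInvariantMeasure (Space N) Ω P]

omit [VAddInvariantMeasure (Space N) Ω P] in
/-- Gradients along a measurable family of points are given by translating the gradient at the
origin. -/
theorem HasStationaryIncrements.ae_ae_gradient (hv : HasStationaryIncrements P v)
    (hm : Measurable v) {T : Type*} [MeasurableSpace T] {μ : Measure T} [SFinite μ]
    {φ : T → Space N} (hφ : Measurable φ) :
    ∀ᵐ ω ∂P, ∀ᵐ t ∂μ, (DifferentiableAt ℝ (v ω) (φ t) ↔
        DifferentiableAt ℝ (v (φ t +ᵥ ω)) 0) ∧
      gradient (v ω) (φ t) = gradient (v (φ t +ᵥ ω)) 0 := by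
  have h1 : Measurable fun q : Ω × T => (v q.1, φ q.2) :=
    (hm.comp measurable_fst).prodMk (hφ.comp measurable_snd)
  have h2 : Measurable fun q : Ω × T => (v (φ q.2 +ᵥ q.1), (0 : Space N)) :=
    (hm.comp ((hφ.comp measurable_snd).vadd measurable_fst)).prodMk measurable_const
  rw [Measure.ae_ae_comm]
  · exact Eventually.of_forall fun t => hv.ae_gradient (φ t)
  · refine MeasurableSet.inter ?_
      (measurableSet_eq_fun (measurable_gradient.comp h1) (measurable_gradient.comp h2))
    exact ((h1 measurableSet_differentiableAt).mem.iff
      (h2 measurableSet_differentiableAt).mem).setOf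

variable (P) in
/-- At the origin, a Lipschitz random function with stationary increments is almost surely
differentiable. -/
theorem ae_differentiableAt_zero (hl : IsLipschitzRandomFunction v)
    (hv : HasStationaryIncrements P v) : ∀ᵐ ω ∂P, DifferentiableAt ℝ (v ω) 0 := by
  obtain ⟨hm, κ, hκ⟩ := hl
  -- Rademacher's theorem gives differentiability of `v ω` at almost every `x`, which by
  -- stationarity is differentiability of `v (x +ᵥ ω)` at the origin.
  rw [← ae_ae_vadd_iff (μ := (volume : Measure (Space N))) measurable_id
    (measurableSet_differentiableAt_zero hm)]
  filter_upwards [hv.ae_ae_gradient hm (μ := (volume : Measure (Space N))) measurable_id]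
    with ω hω
  filter_upwards [hω, (hκ ω).ae_differentiableAt] with x hx hd
  exact hx.1.1 hd

/-- Stationarity of `H` and of the increments identifies the condition at `(x, ω)` with the
condition at `(0, x +ᵥ ω)`; Fubini and invariance of `P` remove `x`. Differentiability at the origin
is automatic. -/
theorem isSubsolution_iff {H : Ω → C(Space N × Space N, ℝ)} (hH : IsStationaryHamiltonian H)
    (hl : IsLipschitzRandomFunction v) (hv : HasStationaryIncrements P v) {a : ℝ} :
    IsSubsolution P H a v ↔ ∀ᵐ ω ∂P, H ω (0, gradient (v ω) 0) ≤ a := by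
  have hm := hl.1
  have hA : MeasurableSet {ω | DifferentiableAt ℝ (v ω) 0 ∧ H ω (0, gradient (v ω) 0) ≤ a} :=
    (measurableSet_differentiableAt_zero hm).inter <| measurableSet_le
      (measurable_hamiltonian_gradient_zero hH.measurable (measurable_gradient_zero hm))
      measurable_const
  have h1 := hv.ae_ae_gradient hm (μ := (volume : Measure (Space N))) measurable_id
  have h2 : ∀ x ω p, H (x +ᵥ ω) (0, p) = H ω (x, p) := fun x ω p => by
    rw [← hH.stationary, zero_add]
  have h3 : IsSubsolution P H a v ↔
      ∀ᵐ ω ∂P, DifferentiableAt ℝ (v ω) 0 ∧ H ω (0, gradient (v ω) 0) ≤ a := by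
    rw [← ae_ae_vadd_iff (μ := (volume : Measure (Space N))) measurable_id hA, IsSubsolution]
    refine eventually_congr ?_
    filter_upwards [h1] with ω hω
    refine eventually_congr ?_
    filter_upwards [hω] with x hx
    simp only [id] at hx ⊢
    rw [hx.1, hx.2, h2]
  rw [h3]
  refine eventually_congr ?_
  filter_upwards [ae_differentiableAt_zero P hl hv] with ω hω
  simp [hω]

-- The gradients at `x` and at the origin have the same law, by invariance of `P`.
omit [IsProbabilityMeasure P] in
theorem hasMeanZeroGradient_iff (hv : HasStationaryIncrements P v) :
    HasMeanZeroGradient P v ↔ ∫ ω, gradient (v ω) 0 ∂P = 0 := by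
  refine ⟨fun h => h 0, fun h x => ?_⟩
  rw [integral_congr_ae ((hv.ae_gradient x).mono fun ω hω => hω.2)]
  rw [(measurePreserving_vadd x P).integral_comp
    (MeasurableEquiv.vadd x).measurableEmbedding (fun ω => gradient (v ω) 0), h]

end StationaryIncrements

/-! ### Strongly convergent convex combinations in a Hilbert space -/

section Hilbert

variable {F : Type*} [NormedAddCommGroup F] [InnerProductSpace ℝ F]

/-- The weights of the finite convex combinations of the indices `n ≥ k`. -/
def tailWeights (k : ℕ) : Set (ℕ →₀ ℝ) :=
  {c | (∀ n ∈ c.support, k ≤ n) ∧ (∀ n, 0 ≤ c n) ∧ (c.sum fun _ t => t) = 1}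

theorem tailWeights_antitone : Antitone tailWeights :=
  fun _ _ h _ hc => ⟨fun n hn => h.trans (hc.1 n hn), hc.2⟩

theorem single_mem_tailWeights (k : ℕ) : Finsupp.single k 1 ∈ tailWeights k := by
  refine ⟨fun n hn => ?_, fun n => ?_, by simp⟩
  · rw [Finsupp.mem_support_iff, Finsupp.single_apply] at hn
    split_ifs at hn with h
    exacts [h.le, absurd rfl hn]
  · rw [Finsupp.single_apply]
    split_ifs <;> norm_num

theorem midpoint_mem_tailWeights {k : ℕ} {c d : ℕ →₀ ℝ} (hc : c ∈ tailWeights k)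
    (hd : d ∈ tailWeights k) : (1 / 2 : ℝ) • (c + d) ∈ tailWeights k := by
  refine ⟨fun n hn => ?_, fun n => ?_, ?_⟩
  · rcases Finset.mem_union.1 (Finsupp.support_add (Finsupp.support_smul hn)) with h | h
    exacts [hc.1 n h, hd.1 n h]
  · have := hc.2.1 n
    have := hd.2.1 n
    simp only [Finsupp.smul_apply, Finsupp.add_apply, smul_eq_mul]
    positivity
  · have h : ∀ c : ℕ →₀ ℝ, (c.sum fun _ t => t) =
        Finsupp.linearCombination ℝ (fun _ => (1 : ℝ)) c := fun c => by
      simp [Finsupp.linearCombination_apply]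
    have h1 := hc.2.2
    have h2 := hd.2.2
    rw [h] at h1 h2 ⊢
    rw [map_smul, map_add, h1, h2]
    norm_num

theorem norm_linearCombination_le {R : ℝ} {u : ℕ → F} (hu : ∀ n, ‖u n‖ ≤ R) {k : ℕ}
    {c : ℕ →₀ ℝ} (hc : c ∈ tailWeights k) : ‖Finsupp.linearCombination ℝ u c‖ ≤ R := by
  have h1 := hc.2.2
  rw [Finsupp.sum] at h1
  rw [Finsupp.linearCombination_apply, Finsupp.sum]
  calc _ ≤ ∑ n ∈ c.support, ‖c n • u n‖ := norm_sum_le _ _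
    _ ≤ ∑ n ∈ c.support, c n * R := Finset.sum_le_sum fun n _ => by
        rw [norm_smul, Real.norm_of_nonneg (hc.2.1 n)]
        exact mul_le_mul_of_nonneg_left (hu n) (hc.2.1 n)
    _ = R := by rw [← Finset.sum_mul, h1, one_mul]

/-- In a Hilbert space, a bounded sequence has convex combinations of its tails that converge in
norm. -/
theorem exists_tailWeights_tendsto [CompleteSpace F] {R : ℝ} {u : ℕ → F} (hu : ∀ n, ‖u n‖ ≤ R) :
    ∃ c : ℕ → ℕ →₀ ℝ, (∀ k, c k ∈ tailWeights k) ∧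
      ∃ y, Tendsto (fun k => Finsupp.linearCombination ℝ u (c k)) atTop (𝓝 y) := by
  set L := Finsupp.linearCombination ℝ u
  set S : ℕ → Set ℝ := fun k => (fun c => ‖L c‖) '' tailWeights k
  have hne : ∀ k, (S k).Nonempty := fun k => ⟨_, _, single_mem_tailWeights k, rfl⟩
  have hbd : ∀ k, BddBelow (S k) := fun k => ⟨0, by rintro _ ⟨c, _, rfl⟩; exact norm_nonneg _⟩
  -- The distance from the origin to the convex hull of the `k`-th tail: nondecreasing and bounded
  -- by `R`. Near-minimizers will form a Cauchy sequence.
  set d : ℕ → ℝ := fun k => sInf (S k)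
  have hd0 : ∀ k, 0 ≤ d k := fun k =>
    le_csInf (hne k) (by rintro _ ⟨c, _, rfl⟩; exact norm_nonneg _)
  have hdle : ∀ k c, c ∈ tailWeights k → d k ≤ ‖L c‖ := fun k c hc => csInf_le (hbd k) ⟨c, hc, rfl⟩
  have hmono : Monotone d := fun k j hkj => by
    refine csInf_le_csInf (hbd k) (hne j) ?_
    exact Set.image_mono (tailWeights_antitone hkj)
  have hdR : ∀ k, d k ≤ R := fun k =>
    (hdle k _ (single_mem_tailWeights k)).trans
      (norm_linearCombination_le hu (single_mem_tailWeights k))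
  have hbdd : BddAbove (Set.range d) := ⟨R, by rintro _ ⟨k, rfl⟩; exact hdR k⟩
  set D := ⨆ k, d k
  have hD : Tendsto d atTop (𝓝 D) := tendsto_atTop_ciSup hmono hbdd
  have hdD : ∀ k, d k ≤ D := fun k => le_ciSup hbdd k
  have hex : ∀ k : ℕ, ∃ c ∈ tailWeights k, ‖L c‖ < d k + 1 / ((k : ℝ) + 1) := fun k => by
    obtain ⟨_, ⟨c, hc, rfl⟩, h⟩ := exists_lt_of_csInf_lt (hne k)
      (lt_add_of_pos_right (d k) (Nat.one_div_pos_of_nat (α := ℝ) (n := k)))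
    exact ⟨c, hc, h⟩
  choose c hc hcd using hex
  refine ⟨c, hc, cauchySeq_tendsto_of_complete ?_⟩
  set ε : ℕ → ℝ := fun k => 1 / ((k : ℝ) + 1)
  have hε : Tendsto ε atTop (𝓝 0) := tendsto_one_div_add_atTop_nhds_zero_nat
  -- Parallelogram law: for `k ≤ j` the midpoint of the two near-minimizers lies in the `k`-th hull,
  -- so its norm is at least `d k`. Bounding `d j` by `D` makes the estimate depend on `k` only.
  refine cauchySeq_of_le_tendsto_0'
    (fun k => Real.sqrt (2 * (d k + ε k) ^ 2 + 2 * (D + ε k) ^ 2 - 4 * d k ^ 2)) ?_ ?_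
  · intro k j hkj
    rw [dist_eq_norm]
    refine Real.le_sqrt_of_sq_le ?_
    have h1 := parallelogram_law_with_norm ℝ (L (c k)) (L (c j))
    have h2 := hdle k _ (midpoint_mem_tailWeights (hc k) (tailWeights_antitone hkj (hc j)))
    rw [map_smul, map_add, norm_smul, Real.norm_of_nonneg (by norm_num)] at h2
    have h3 : ‖L (c j)‖ ≤ D + ε k := by
      have : ε j ≤ ε k := by simp only [ε]; gcongr
      linarith [hcd j, hdD j]
    have h4 := (hcd k).le
    have h5 : ‖L (c k)‖ ^ 2 ≤ (d k + ε k) ^ 2 := pow_le_pow_left₀ (norm_nonneg _) h4 2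
    have h6 : ‖L (c j)‖ ^ 2 ≤ (D + ε k) ^ 2 := pow_le_pow_left₀ (norm_nonneg _) h3 2
    have h7 : (2 * d k) ^ 2 ≤ ‖L (c k) + L (c j)‖ ^ 2 :=
      pow_le_pow_left₀ (by linarith [hd0 k]) (by linarith) 2
    linarith
  · have h : Tendsto (fun k => Real.sqrt (2 * (d k + ε k) ^ 2 + 2 * (D + ε k) ^ 2 - 4 * d k ^ 2))
        atTop (𝓝 (Real.sqrt (2 * (D + 0) ^ 2 + 2 * (D + 0) ^ 2 - 4 * D ^ 2))) :=
      (((((hD.add hε).pow 2).const_mul 2).add (((tendsto_const_nhds.add hε).pow 2).const_mul 2)).sub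
        ((hD.pow 2).const_mul 4)).sqrt
    convert h using 2
    rw [eq_comm, Real.sqrt_eq_zero']
    exact le_of_eq (by ring)

end Hilbert

/-! ### Compactness of equi-Lipschitz sequences -/

section Lipschitz

variable {X : Type*} [PseudoMetricSpace X] {κ : ℝ≥0} {f : ℕ → C(X, ℝ)}

theorem equicontinuous_of_lipschitzWith {ι : Type*} {f : ι → X → ℝ}
    (hf : ∀ i, LipschitzWith κ (f i)) : Equicontinuous f :=
  (LipschitzWith.uniformEquicontinuous f κ hf).equicontinuous

/-- Equicontinuity upgrades pointwise convergence to convergence uniform on compact sets. -/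
theorem tendsto_continuousMap_of_lipschitzWith (hf : ∀ k, LipschitzWith κ (f k)) {g : C(X, ℝ)}
    (hg : ∀ x, Tendsto (fun k => f k x) atTop (𝓝 (g x))) : Tendsto f atTop (𝓝 g) := by
  rw [ContinuousMap.tendsto_iff_forall_isCompact_tendstoUniformlyOn]
  have h := (EquicontinuousOn.tendsto_uniformOnFun_iff_pi (F := fun k => (f k : X → ℝ))
    (𝔖 := {K : Set X | IsCompact K}) (fun K hK => hK)
    (Set.eq_univ_of_forall fun x => ⟨{x}, isCompact_singleton, rfl⟩)
    (fun K _ => (equicontinuous_of_lipschitzWith hf).equicontinuousOn K) atTop g).2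
    (tendsto_pi_nhds.2 hg)
  rw [UniformOnFun.tendsto_iff_tendstoUniformlyOn] at h
  exact h

/-- A sequence of `κ`-Lipschitz functions that is pointwise Cauchy on a dense set converges
locally uniformly to a `κ`-Lipschitz function. -/
theorem exists_lipschitzWith_tendsto (hf : ∀ k, LipschitzWith κ (f k)) {s : Set X} (hs : Dense s)
    (hc : ∀ x ∈ s, CauchySeq fun k => f k x) :
    ∃ g : C(X, ℝ), LipschitzWith κ g ∧ Tendsto f atTop (𝓝 g) := by
  have hall : ∀ x, ∃ y, Tendsto (fun k => f k x) atTop (𝓝 y) := fun x => by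
    refine cauchySeq_tendsto_of_complete (Metric.cauchySeq_iff.2 fun ε hε => ?_)
    obtain ⟨z, hz, hzs⟩ := Metric.dense_iff.1 hs x (ε / (3 * (κ + 1))) (by positivity)
    obtain ⟨n, hn⟩ := Metric.cauchySeq_iff.1 (hc z hzs) (ε / 3) (by positivity)
    have hκ : κ * dist x z ≤ ε / 3 := by
      have h1 : dist x z ≤ ε / (3 * (κ + 1)) := by
        rw [dist_comm]; exact (Metric.mem_ball.1 hz).le
      calc (κ : ℝ) * dist x z ≤ (κ + 1) * (ε / (3 * (κ + 1))) := by gcongr; linarith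
        _ = ε / 3 := by field_simp
    refine ⟨n, fun k hk j hj => ?_⟩
    have h2 := (hf k).dist_le_mul x z
    have h3 := (hf j).dist_le_mul z x
    rw [dist_comm z x] at h3
    calc dist (f k x) (f j x)
        ≤ dist (f k x) (f k z) + dist (f k z) (f j z) + dist (f j z) (f j x) := dist_triangle4 _ _ _ _
      _ < ε / 3 + ε / 3 + ε / 3 := by linarith [hn k hk j hj]
      _ = ε := by ring
  choose g hg using hall
  have hgl : LipschitzWith κ g := LipschitzWith.of_dist_le_mul fun x y =>
    le_of_tendsto ((hg x).dist (hg y)) (Eventually.of_forall fun k => (hf k).dist_le_mul x y)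
  exact ⟨⟨g, hgl.continuous⟩, hgl, tendsto_continuousMap_of_lipschitzWith hf hg⟩

end Lipschitz

/-! ### Lipschitz functions along lines -/

section Line

variable {N : ℕ}

theorem hasDerivAt_line {f : Space N → ℝ} {x e : Space N} {t : ℝ}
    (hf : DifferentiableAt ℝ f (x + t • e)) :
    HasDerivAt (fun t : ℝ => f (x + t • e)) (inner ℝ (gradient f (x + t • e)) e) t := by
  rw [inner_gradient_left]
  have h : HasDerivAt (fun t : ℝ => x + t • e) e t := by
    simpa using ((hasDerivAt_id t).smul_const e).const_add x
  exact hf.hasFDerivAt.comp_hasDerivAt t h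

/-- The fundamental theorem of calculus for a Lipschitz function along a line on which it is almost
everywhere differentiable as a function of several variables. -/
theorem sub_eq_integral_gradient {f : Space N → ℝ} {κ : ℝ≥0} (hf : LipschitzWith κ f)
    {x e : Space N} (hd : ∀ᵐ t : ℝ, DifferentiableAt ℝ f (x + t • e)) (T : ℝ) :
    f (x + T • e) - f x = ∫ t in (0 : ℝ)..T, inner ℝ (gradient f (x + t • e)) e := by
  have hL : LipschitzWith (κ * ‖e‖₊) fun t : ℝ => f (x + t • e) := by
    refine LipschitzWith.of_dist_le_mul fun s t => (hf.dist_le_mul _ _).trans_eq ?_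
    rw [dist_add_left, dist_eq_norm, ← sub_smul, norm_smul, Real.dist_eq, Real.norm_eq_abs]
    push_cast
    ring
  have h := (hL.lipschitzOnWith (s := Set.uIcc 0 T)).absolutelyContinuousOnInterval.integral_deriv_eq_sub
  simp only [zero_smul, add_zero] at h
  rw [← h]
  refine intervalIntegral.integral_congr_ae ?_
  filter_upwards [hd] with t ht _ using (hasDerivAt_line ht).deriv

theorem dist_le_of_norm_gradient_le {f : Space N → ℝ} {κ : ℝ≥0} (hf : LipschitzWith κ f)
    {x e : Space N} {R : ℝ}
    (hd : ∀ᵐ t : ℝ, DifferentiableAt ℝ f (x + t • e) ∧ ‖gradient f (x + t • e)‖ ≤ R) :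
    dist (f (x + e)) (f x) ≤ R * ‖e‖ := by
  have h := sub_eq_integral_gradient hf (hd.mono fun t ht => ht.1) 1
  rw [one_smul] at h
  rw [dist_eq_norm, h]
  refine (intervalIntegral.norm_integral_le_of_norm_le_const_ae (C := R * ‖e‖) ?_).trans_eq
    (by simp)
  filter_upwards [hd] with t ht _
  exact (norm_inner_le_norm _ _).trans (mul_le_mul_of_nonneg_right ht.2 (norm_nonneg _))

end Line

/-! ### Random functions along lines -/

section Random

variable {N : ℕ} {Ω : Type*} [MeasurableSpace Ω] [AddAction (Space N) Ω]
  {P : Measure Ω} {v : Ω → C(Space N, ℝ)} [MeasurableVAdd₂ (Space N) Ω] [IsProbabilityMeasure P]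
  [VAddInvariantMeasure (Space N) Ω P]

theorem measurable_line (x e : Space N) : Measurable fun t : ℝ => x + t • e :=
  (by fun_prop : Continuous fun t : ℝ => x + t • e).measurable

-- A line may be a null set, so Rademacher's theorem for a fixed `ω` says nothing about it. Almost
-- sure differentiability at each fixed point, combined with Fubini in `(ω, t)`, does.
variable (P) in
theorem ae_ae_gradient_line (hl : IsLipschitzRandomFunction v) (hv : HasStationaryIncrements P v)
    (x e : Space N) :
    ∀ᵐ ω ∂P, ∀ᵐ t : ℝ, DifferentiableAt ℝ (v ω) (x + t • e) ∧
      gradient (v ω) (x + t • e) = gradient (v ((x + t • e) +ᵥ ω)) 0 := by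
  filter_upwards [hv.ae_ae_gradient hl.1 (μ := (volume : Measure ℝ)) (measurable_line x e),
    ae_ae_vadd (μ := (volume : Measure ℝ)) (measurable_line x e)
      (ae_differentiableAt_zero P hl hv)] with ω h1 h2
  filter_upwards [h1, h2] with t h3 h4
  exact ⟨h3.1.2 h4, h3.2⟩

/-- Supplies one Lipschitz constant for a whole sequence, whose individual constants need not be
bounded. Each pair of points is handled by integrating the gradient along the segment; a countable
dense set leaves a single null event. -/
theorem ae_lipschitzWith (hl : IsLipschitzRandomFunction v) (hv : HasStationaryIncrements P v)
    {R : ℝ≥0} (hR : ∀ᵐ ω ∂P, ‖gradient (v ω) 0‖ ≤ R) : ∀ᵐ ω ∂P, LipschitzWith R (v ω) := by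
  obtain ⟨κ, hκ⟩ := hl.2
  have h : ∀ x y : Space N, ∀ᵐ ω ∂P, dist (v ω y) (v ω x) ≤ R * dist y x := fun x y => by
    filter_upwards [ae_ae_gradient_line P hl hv x (y - x),
      ae_ae_vadd (μ := (volume : Measure ℝ)) (measurable_line x (y - x)) hR] with ω h1 h2
    have h3 := dist_le_of_norm_gradient_le (hκ ω) (x := x) (e := y - x) (R := R) (by
      filter_upwards [h1, h2] with t h3 h4
      exact ⟨h3.1, h3.2 ▸ h4⟩)
    rwa [add_sub_cancel, ← dist_eq_norm] at h3
  have h' : ∀ᵐ ω ∂P, ∀ i j : ℕ, dist (v ω (TopologicalSpace.denseSeq _ i))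
      (v ω (TopologicalSpace.denseSeq _ j)) ≤ R * dist (TopologicalSpace.denseSeq (Space N) i)
        (TopologicalSpace.denseSeq (Space N) j) :=
    ae_all_iff.2 fun i => ae_all_iff.2 fun j => h _ _
  filter_upwards [h'] with ω hω
  rw [← lipschitzOnWith_univ, ← (TopologicalSpace.denseRange_denseSeq (Space N)).closure_range]
  refine LipschitzOnWith.closure (v ω).continuous.continuousOn ?_
  refine LipschitzOnWith.of_dist_le_mul ?_
  rintro _ ⟨i, rfl⟩ _ ⟨j, rfl⟩
  exact hω i j

end Random

/-! ### Normalization at the origin -/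

section Center

variable {N : ℕ}

/-- The translate of a function by a constant that vanishes at the origin. -/
noncomputable def center (f : C(Space N, ℝ)) : C(Space N, ℝ) := f - ContinuousMap.const _ (f 0)

theorem center_apply (f : C(Space N, ℝ)) (x : Space N) : center f x = f x - f 0 := rfl

theorem measurable_center : Measurable (center : C(Space N, ℝ) → C(Space N, ℝ)) := by
  refine Continuous.measurable (continuous_id.sub ?_)
  exact ContinuousMap.continuous_const'.comp (ContinuousEvalConst.continuous_eval_const 0)

theorem lipschitzWith_center {f : C(Space N, ℝ)} {κ : ℝ≥0} (hf : LipschitzWith κ f) :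
    LipschitzWith κ (center f) := LipschitzWith.of_dist_le_mul fun x y => by
  simpa [center_apply] using hf.dist_le_mul x y

end Center

/-! ### Limit of random functions and its gradient -/

section Limit

variable {N : ℕ} {Ω : Type*} [MeasurableSpace Ω] [AddAction (Space N) Ω]
  {P : Measure Ω} [MeasurableVAdd₂ (Space N) Ω] [IsProbabilityMeasure P]
  [VAddInvariantMeasure (Space N) Ω P] {w : ℕ → Ω → C(Space N, ℝ)} {R : ℝ≥0} {Φ : Ω → Space N}

/-- If the gradients at the origin converge almost surely and boundedly, then the functions
converge along every line through the origin to the integral of the limit of the gradients. -/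
theorem ae_tendsto_line (hl : ∀ k, IsLipschitzRandomFunction (w k))
    (hs : ∀ k, HasStationaryIncrements P (w k))
    (hR : ∀ k, ∀ᵐ ω ∂P, ‖gradient (w k ω) 0‖ ≤ R)
    (hΦ : ∀ᵐ ω ∂P, Tendsto (fun k => gradient (w k ω) 0) atTop (𝓝 (Φ ω))) (e : Space N) :
    ∀ᵐ ω ∂P, ∀ T : ℝ, Tendsto (fun k => center (w k ω) (T • e)) atTop
      (𝓝 (∫ t in (0 : ℝ)..T, inner ℝ (Φ ((t • e) +ᵥ ω)) e)) := by
  have hm : Measurable fun t : ℝ => t • e := by simpa using measurable_line 0 e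
  have h1 := ae_all_iff.2 fun k => ae_ae_gradient_line P (hl k) (hs k) 0 e
  have h2 := ae_all_iff.2 fun k => ae_ae_vadd (μ := (volume : Measure ℝ)) hm (hR k)
  have h3 := ae_ae_vadd (μ := (volume : Measure ℝ)) hm hΦ
  filter_upwards [h1, h2, h3] with ω h1 h2 h3 T
  simp only [zero_add] at h1
  have h4 : ∀ k, center (w k ω) (T • e) =
      ∫ t in (0 : ℝ)..T, inner ℝ (gradient (w k ω) (t • e)) e := fun k => by
    obtain ⟨κ, hκ⟩ := (hl k).2
    have := sub_eq_integral_gradient (hκ ω) (x := 0) (e := e)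
      ((h1 k).mono fun t ht => by simpa using ht.1) T
    simpa [center_apply] using this
  simp_rw [h4]
  refine intervalIntegral.tendsto_integral_filter_of_dominated_convergence (fun _ => R * ‖e‖)
    (Eventually.of_forall fun k => ?_) (Eventually.of_forall fun k => ?_) (by simp) ?_
  · refine Measurable.aestronglyMeasurable ?_
    exact (measurable_gradient.comp (measurable_const.prodMk hm)).inner measurable_const
  · filter_upwards [h1 k, h2 k] with t h5 h6 _
    refine (norm_inner_le_norm _ _).trans (mul_le_mul_of_nonneg_right ?_ (norm_nonneg _))
    rwa [h5.2]
  · filter_upwards [ae_all_iff.2 h1, h3] with t h5 h6 _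
    simp_rw [(h5 _).2]
    exact h6.inner tendsto_const_nhds

/-- Construction of the limit of a sequence of Lipschitz random functions with stationary
increments whose gradients at the origin converge almost surely and boundedly. -/
theorem exists_limit_randomFunction (hl : ∀ k, IsLipschitzRandomFunction (w k))
    (hs : ∀ k, HasStationaryIncrements P (w k))
    (hR : ∀ k, ∀ᵐ ω ∂P, ‖gradient (w k ω) 0‖ ≤ R)
    (hΦ : ∀ᵐ ω ∂P, Tendsto (fun k => gradient (w k ω) 0) atTop (𝓝 (Φ ω))) :
    ∃ v : Ω → C(Space N, ℝ), IsLipschitzRandomFunction v ∧ HasStationaryIncrements P v ∧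
      ∀ᵐ ω ∂P, Tendsto (fun k => center (w k ω)) atTop (𝓝 (v ω)) := by
  have h1 : ∀ᵐ ω ∂P, (∀ k, LipschitzWith R (w k ω)) ∧ ∀ i : ℕ,
      CauchySeq fun k => center (w k ω) (TopologicalSpace.denseSeq (Space N) i) := by
    filter_upwards [ae_all_iff.2 fun k => ae_lipschitzWith (hl k) (hs k) (hR k),
      ae_all_iff.2 fun i : ℕ =>
        ae_tendsto_line hl hs hR hΦ (TopologicalSpace.denseSeq (Space N) i)] with ω h1 h2
    refine ⟨h1, fun i => ?_⟩
    have := h2 i 1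
    rw [one_smul] at this
    exact this.cauchySeq
  obtain ⟨s, hsP, hsm, hsp⟩ := Eventually.exists_measurable_mem h1
  have h2 : ∀ ω ∈ s, ∃ g : C(Space N, ℝ), LipschitzWith R g ∧
      Tendsto (fun k => center (w k ω)) atTop (𝓝 g) := fun ω hω =>
    exists_lipschitzWith_tendsto (fun k => lipschitzWith_center ((hsp ω hω).1 k))
      (TopologicalSpace.denseRange_denseSeq (Space N))
      (by rintro _ ⟨i, rfl⟩; exact (hsp ω hω).2 i)
  classical
  -- Setting the limit to `0` off a measurable event of full measure keeps it measurable, and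
  -- Lipschitz for every `ω` rather than almost every one.
  let v : Ω → C(Space N, ℝ) := fun ω => if hω : ω ∈ s then (h2 ω hω).choose else 0
  have hv : ∀ ω ∈ s, LipschitzWith R (v ω) ∧ Tendsto (fun k => center (w k ω)) atTop (𝓝 (v ω)) :=
    fun ω hω => by
      simp only [v, dif_pos hω]
      exact (h2 ω hω).choose_spec
  have hv0 : ∀ ω ∉ s, v ω = 0 := fun ω hω => dif_neg hω
  refine ⟨v, ⟨?_, R, fun ω => ?_⟩, fun z => ?_, ?_⟩
  · refine measurable_of_tendsto_metrizable (f := fun k ω => s.indicator (fun ω => center (w k ω)) ω)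
      (fun k => (measurable_center.comp (hl k).1).indicator hsm) (tendsto_pi_nhds.2 fun ω => ?_)
    by_cases hω : ω ∈ s
    · simpa only [Set.indicator_of_mem hω] using (hv ω hω).2
    · simp only [Set.indicator_of_notMem hω, hv0 ω hω]
      exact tendsto_const_nhds
  · by_cases hω : ω ∈ s
    · exact (hv ω hω).1
    · rw [hv0 ω hω]
      exact LipschitzWith.const' 0
  · filter_upwards [hsP, ae_vadd hsP z, ae_all_iff.2 fun k => hs k z] with ω h3 h4 h5 x y
    -- The random constant removed by `center` cancels in increments, so stationarity survives the
    -- limit.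
    have h6 : ∀ ω ∈ s, ∀ x y, Tendsto (fun k => w k ω x - w k ω y) atTop (𝓝 (v ω x - v ω y)) :=
      fun ω hω x y => by
        have h7 := fun x => ((ContinuousEvalConst.continuous_eval_const x).tendsto (v ω)).comp
          (hv ω hω).2
        simpa [Function.comp_def, center_apply] using (h7 x).sub (h7 y)
    have h7 := h6 _ h4 x y
    simp_rw [← h5] at h7
    exact tendsto_nhds_unique (h6 ω h3 _ _) h7
  · filter_upwards [hsP] with ω hω using (hv ω hω).2

/-- The gradient at the origin of the limit is the limit of the gradients at the origin. -/
theorem ae_gradient_limit_eq (hl : ∀ k, IsLipschitzRandomFunction (w k))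
    (hs : ∀ k, HasStationaryIncrements P (w k))
    (hR : ∀ k, ∀ᵐ ω ∂P, ‖gradient (w k ω) 0‖ ≤ R) (hΦm : Measurable Φ)
    (hΦ : ∀ᵐ ω ∂P, Tendsto (fun k => gradient (w k ω) 0) atTop (𝓝 (Φ ω)))
    {v : Ω → C(Space N, ℝ)} (hvl : IsLipschitzRandomFunction v)
    (hvs : HasStationaryIncrements P v)
    (hv : ∀ᵐ ω ∂P, Tendsto (fun k => center (w k ω)) atTop (𝓝 (v ω))) :
    ∀ᵐ ω ∂P, gradient (v ω) 0 = Φ ω := by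
  have hΦR : ∀ᵐ ω ∂P, ‖Φ ω‖ ≤ R := by
    filter_upwards [hΦ, ae_all_iff.2 hR] with ω h1 h2
    exact le_of_tendsto h1.norm (Eventually.of_forall h2)
  have key : ∀ e : Space N, ∀ᵐ ω ∂P, inner ℝ (gradient (v ω) 0) e = inner ℝ (Φ ω) e := fun e => by
    have hm : Measurable fun t : ℝ => t • e := by simpa using measurable_line 0 e
    -- Lebesgue differentiation works only at almost every `t`, so the identity is proved at almost
    -- every point of the line and transferred back to the origin.
    rw [← ae_ae_vadd_iff (μ := (volume : Measure ℝ)) hm (measurableSet_eq_fun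
      ((measurable_gradient_zero hvl.1).inner measurable_const) (hΦm.inner measurable_const))]
    filter_upwards [ae_tendsto_line hl hs hR hΦ e, hv, ae_ae_gradient_line P hvl hvs 0 e,
      ae_ae_vadd (μ := (volume : Measure ℝ)) hm hΦR] with ω h1 h2 h3 h4
    have h5 : ∀ T : ℝ, v ω (0 + T • e) = ∫ t in (0 : ℝ)..T, inner ℝ (Φ ((t • e) +ᵥ ω)) e :=
      fun T => by
        rw [zero_add]
        exact tendsto_nhds_unique
          (((ContinuousEvalConst.continuous_eval_const (T • e)).tendsto (v ω)).comp h2) (h1 T)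
    have h6 : LocallyIntegrable (fun t : ℝ => inner ℝ (Φ ((t • e) +ᵥ ω)) e) volume := by
      refine (locallyIntegrable_const (R * ‖e‖ : ℝ)).mono ?_ ?_
      · exact ((hΦm.comp (hm.vadd_const ω)).inner measurable_const).aestronglyMeasurable
      · filter_upwards [h4] with t ht
        rw [Real.norm_of_nonneg (by positivity : (0 : ℝ) ≤ R * ‖e‖)]
        exact (norm_inner_le_norm _ _).trans (mul_le_mul_of_nonneg_right ht (norm_nonneg _))
    filter_upwards [LocallyIntegrable.ae_hasDerivAt_integral h6, h3] with t h7 h8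
    have h9 := hasDerivAt_line h8.1
    rw [h8.2] at h9
    simp_rw [h5] at h9
    have := h9.unique (h7 0)
    simpa using this
  have h := ae_all_iff.2 fun i => key (EuclideanSpace.basisFun (Fin N) ℝ i)
  filter_upwards [h] with ω hω
  ext i
  simpa [-inner_gradient_left, EuclideanSpace.inner_single_right] using hω i

end Limit

/-! ### Uniform coercivity and lower bound of the Hamiltonian -/

section Hamiltonian

variable {N : ℕ} {Ω : Type*} [MeasurableSpace Ω] [AddAction (Space N) Ω]
  {H : Ω → C(Space N × Space N, ℝ)}

theorem IsStationaryHamiltonian.coercive (hH : IsStationaryHamiltonian H) (a : ℝ) :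
    ∃ R : ℝ≥0, ∀ ω x p, H ω (x, p) ≤ a → ‖p‖ ≤ R := by
  obtain ⟨α, β, hα, -, h⟩ := hH.growth
  -- Beyond radius `max R 1`, `α h ≥ (|a| + 1) * h ≥ |a| + 1 > a`.
  obtain ⟨R, hR⟩ := (tendsto_atTop.1 hα (|a| + 1)).exists_forall_of_atTop
  refine ⟨(max R 1).toNNReal, fun ω x p hp => ?_⟩
  rw [Real.coe_toNNReal _ (le_max_of_le_right zero_le_one)]
  by_contra! hlt
  have h1 : 1 < ‖p‖ := (le_max_right _ _).trans_lt hlt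
  have h2 := hR ‖p‖ ((le_max_left _ _).trans hlt.le)
  rw [le_div_iff₀ (by linarith)] at h2
  have h3 := (h x p ω).1
  have h4 : |a| + 1 ≤ (|a| + 1) * ‖p‖ := le_mul_of_one_le_right (by positivity) h1.le
  linarith [le_abs_self a]

/-- A Hamiltonian is bounded below, by convexity and the bounds at the origin and on a sphere. -/
theorem IsStationaryHamiltonian.exists_lower_bound (hH : IsStationaryHamiltonian H) :
    ∃ B : ℝ, ∀ ω x p, B ≤ H ω (x, p) := by
  obtain ⟨α, β, hα, -, h⟩ := hH.growth
  obtain ⟨R, hR⟩ := hH.coercive 0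
  set r : ℝ := R + 1
  have hr : 0 < r := by positivity
  -- Superlinearity does not bound `α` below on bounded sets, so only the values `α 0` and `β r`
  -- enter.
  refine ⟨min 0 (2 * α 0 - max (β r) 0 - |α 0|), fun ω x p => ?_⟩
  by_cases hp : H ω (x, p) ≤ 0
  swap
  · exact (min_le_left _ _).trans (not_le.1 hp).le
  refine (min_le_right _ _).trans ?_
  have hpr : ‖p‖ ≤ r := (hR ω x p hp).trans (by simp [r])
  rcases eq_or_ne p 0 with rfl | hp0
  · have h1 := (h x 0 ω).1
    rw [norm_zero] at h1
    linarith [le_abs_self (α 0), le_max_right (β r) 0]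
  have hpos : 0 < ‖p‖ := norm_pos_iff.2 hp0
  -- The point of the sphere of radius `r` opposite to `p`: the origin is a convex combination of
  -- `p` and `q`, and `H` is bounded below at the origin and above at `q`.
  set q : Space N := -(r / ‖p‖) • p
  have hq : ‖q‖ = r := by
    rw [norm_smul, norm_neg, Real.norm_of_nonneg (by positivity), div_mul_cancel₀ _ hpos.ne']
  have h1 := (hH.convex x ω).2 (Set.mem_univ p) (Set.mem_univ q)
    (by positivity : 0 ≤ r / (r + ‖p‖)) (by positivity : 0 ≤ ‖p‖ / (r + ‖p‖)) (by field_simp)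
  have h2 : (r / (r + ‖p‖)) • p + (‖p‖ / (r + ‖p‖)) • q = 0 := by
    rw [smul_smul, ← add_smul]
    convert zero_smul ℝ p
    field_simp
    ring
  rw [h2] at h1
  have h3 := (h x 0 ω).1
  have h4 := (h x q ω).2
  rw [norm_zero] at h3
  rw [hq] at h4
  simp only [smul_eq_mul] at h1
  have h5 : α 0 * (r + ‖p‖) ≤ r * H ω (x, p) + ‖p‖ * max (β r) 0 := by
    have h6 : (r / (r + ‖p‖)) * H ω (x, p) + (‖p‖ / (r + ‖p‖)) * H ω (x, q)
        = (r * H ω (x, p) + ‖p‖ * H ω (x, q)) / (r + ‖p‖) := by ring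
    rw [h6] at h1
    have h7 := (le_div_iff₀ (by positivity)).1 (h3.trans h1)
    have h8 : ‖p‖ * H ω (x, q) ≤ ‖p‖ * max (β r) 0 :=
      mul_le_mul_of_nonneg_left (h4.trans (le_max_left _ _)) hpos.le
    linarith
  have h6 : ‖p‖ * max (β r) 0 ≤ r * max (β r) 0 :=
    mul_le_mul_of_nonneg_right hpr (le_max_right _ _)
  -- Since `r ≤ r + ‖p‖ ≤ 2 * r`, the term `|α 0|` leaves enough room for either sign of `α 0`.
  have h7 : (2 * α 0 - |α 0|) * r ≤ α 0 * (r + ‖p‖) := by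
    rcases le_total 0 (α 0) with h0 | h0
    · rw [abs_of_nonneg h0]; nlinarith
    · rw [abs_of_nonpos h0]; nlinarith
  have h8 : r * (2 * α 0 - max (β r) 0 - |α 0|) ≤ r * H ω (x, p) := by linarith
  exact le_of_mul_le_mul_left h8 hr

end Hamiltonian

/-! ### Convex combinations of admissible subsolutions -/

section Combination

variable {N : ℕ} {Ω : Type*} [MeasurableSpace Ω] [AddAction (Space N) Ω]
  {P : Measure Ω} [MeasurableVAdd₂ (Space N) Ω] [IsProbabilityMeasure P]
  [VAddInvariantMeasure (Space N) Ω P] {v : ℕ → Ω → C(Space N, ℝ)}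

/-- A finite linear combination of random functions. -/
noncomputable def combination (v : ℕ → Ω → C(Space N, ℝ)) (c : ℕ →₀ ℝ) (ω : Ω) :
    C(Space N, ℝ) :=
  c.sum fun n t => t • v n ω

omit [MeasurableSpace Ω] [AddAction (Space N) Ω] [MeasurableVAdd₂ (Space N) Ω] in
theorem combination_apply (c : ℕ →₀ ℝ) (ω : Ω) (x : Space N) :
    combination v c ω x = c.sum fun n t => t * v n ω x := by
  simp [combination, Finsupp.sum, ContinuousMap.sum_apply]

omit [AddAction (Space N) Ω] [MeasurableVAdd₂ (Space N) Ω] in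
theorem isLipschitzRandomFunction_combination (hv : ∀ n, IsLipschitzRandomFunction (v n))
    (c : ℕ →₀ ℝ) : IsLipschitzRandomFunction (combination v c) := by
  refine ⟨?_, ?_⟩
  · have h (n : ℕ) : Measurable fun ω => c n • v n ω := (hv n).1.const_smul (c n)
    exact Finset.measurable_sum _ fun n _ => h n
  choose κ hκ using fun n => (hv n).2
  refine ⟨∑ n ∈ c.support, ‖c n‖₊ * κ n, fun ω => LipschitzWith.of_dist_le_mul fun x y => ?_⟩
  rw [combination_apply, combination_apply]
  refine (dist_sum_sum_le _ _ _).trans ?_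
  push_cast
  rw [Finset.sum_mul]
  refine Finset.sum_le_sum fun n _ => ?_
  rw [Real.dist_eq, ← mul_sub, abs_mul, mul_assoc]
  exact mul_le_mul_of_nonneg_left ((hκ n ω).dist_le_mul x y) (abs_nonneg _)

omit [MeasurableVAdd₂ (Space N) Ω] [IsProbabilityMeasure P]
  [VAddInvariantMeasure (Space N) Ω P] in
theorem hasStationaryIncrements_combination (hv : ∀ n, HasStationaryIncrements P (v n))
    (c : ℕ →₀ ℝ) : HasStationaryIncrements P (combination v c) := fun z => by
  filter_upwards [ae_all_iff.2 fun n => hv n z] with ω hω x y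
  simp only [combination_apply, Finsupp.sum, ← Finset.sum_sub_distrib, ← mul_sub, hω]

variable (P) in
theorem ae_gradient_combination (hl : ∀ n, IsLipschitzRandomFunction (v n))
    (hs : ∀ n, HasStationaryIncrements P (v n)) (c : ℕ →₀ ℝ) :
    ∀ᵐ ω ∂P, gradient (combination v c ω) 0 =
      Finsupp.linearCombination ℝ (fun n => gradient (v n ω) 0) c := by
  filter_upwards [ae_all_iff.2 fun n => ae_differentiableAt_zero P (hl n) (hs n)] with ω hω
  refine HasGradientAt.gradient ?_
  rw [hasGradientAt_iff_hasFDerivAt]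
  have h1 : (combination v c ω : Space N → ℝ) = fun x => ∑ n ∈ c.support, c n • v n ω x := by
    funext x
    rw [combination_apply, Finsupp.sum]
    simp
  rw [h1, Finsupp.linearCombination_apply, Finsupp.sum, map_sum]
  refine HasFDerivAt.fun_sum fun n _ => ?_
  rw [map_smul]
  exact (hω n).hasGradientAt.hasFDerivAt.const_smul (c n)

omit [AddAction (Space N) Ω] [MeasurableVAdd₂ (Space N) Ω]
  [VAddInvariantMeasure (Space N) Ω P] in
theorem memLp_gradient_zero {v : Ω → C(Space N, ℝ)} (hv : IsLipschitzRandomFunction v)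
    (p : ENNReal) : MemLp (fun ω => gradient (v ω) 0) p P := by
  obtain ⟨hm, κ, hκ⟩ := hv
  exact MemLp.of_bound (measurable_gradient_zero hm).aestronglyMeasurable κ
    (Eventually.of_forall fun ω => norm_gradient_le_of_lipschitzWith (hκ ω) 0)

theorem integral_gradient_combination (hv : ∀ n, IsAdmissible P (v n)) (c : ℕ →₀ ℝ) :
    ∫ ω, gradient (combination v c ω) 0 ∂P = 0 := by
  rw [integral_congr_ae (ae_gradient_combination P (fun n => (hv n).lipschitz)
    (fun n => (hv n).stationaryIncrements) c)]
  simp only [Finsupp.linearCombination_apply, Finsupp.sum]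
  rw [integral_finsetSum]
  · refine Finset.sum_eq_zero fun n _ => ?_
    rw [integral_smul, (hv n).meanZeroGradient 0, smul_zero]
  · intro n _
    exact ((memLp_gradient_zero (hv n).lipschitz 1).integrable le_rfl).smul (c n)

/-- Jensen's inequality for the convex function `H ω (0, ·)`. Only levels of index at least `k`
count, which later lets `b` approach the limit level. -/
theorem ae_hamiltonian_combination_le {H : Ω → C(Space N × Space N, ℝ)}
    (hH : IsStationaryHamiltonian H) {a : ℕ → ℝ} (hv : ∀ n, v n ∈ admissibleSubsolutions P H (a n))
    {k : ℕ} {c : ℕ →₀ ℝ} (hc : c ∈ tailWeights k) {b : ℝ} (hb : ∀ n, k ≤ n → a n ≤ b) :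
    ∀ᵐ ω ∂P, H ω (0, gradient (combination v c ω) 0) ≤ b := by
  filter_upwards [ae_gradient_combination P (fun n => (hv n).1.lipschitz)
      (fun n => (hv n).1.stationaryIncrements) c,
    ae_all_iff.2 fun n => (isSubsolution_iff hH (hv n).1.lipschitz
      (hv n).1.stationaryIncrements).1 (hv n).2] with ω h1 h2
  have hsum := hc.2.2
  rw [Finsupp.sum] at hsum
  rw [h1, Finsupp.linearCombination_apply, Finsupp.sum]
  refine ((hH.convex 0 ω).map_sum_le (fun n _ => hc.2.1 n) hsum
    fun n _ => Set.mem_univ _).trans ?_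
  calc ∑ n ∈ c.support, c n • H ω (0, gradient (v n ω) 0)
      ≤ ∑ n ∈ c.support, c n * b := Finset.sum_le_sum fun n hn =>
        mul_le_mul_of_nonneg_left ((h2 n).trans (hb n (hc.1 n hn))) (hc.2.1 n)
    _ = b := by rw [← Finset.sum_mul, hsum, one_mul]

end Combination

/-! ### Stability and the critical value -/

section Main

variable {N : ℕ} {Ω : Type*} [MeasurableSpace Ω] [AddAction (Space N) Ω]
  {P : Measure Ω} [MeasurableVAdd₂ (Space N) Ω] [IsProbabilityMeasure P]
  [VAddInvariantMeasure (Space N) Ω P] {H : Ω → C(Space N × Space N, ℝ)}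

omit [AddAction (Space N) Ω] [MeasurableVAdd₂ (Space N) Ω] [IsProbabilityMeasure P]
  [VAddInvariantMeasure (Space N) Ω P] in
theorem coeFn_linearCombination {E : Type*} [NormedAddCommGroup E] [NormedSpace ℝ E]
    {p : ENNReal} (u : ℕ → Lp E p P) (c : ℕ →₀ ℝ) :
    ∀ᵐ ω ∂P, (Finsupp.linearCombination ℝ u c) ω =
      Finsupp.linearCombination ℝ (fun n => u n ω) c := by
  induction c using Finsupp.induction_linear with
  | zero =>
    filter_upwards [Lp.coeFn_zero E p P] with ω hω
    simpa using hω
  | add c d hc hd =>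
    rw [map_add]
    filter_upwards [Lp.coeFn_add (Finsupp.linearCombination ℝ u c)
      (Finsupp.linearCombination ℝ u d), hc, hd] with ω h1 h2 h3
    rw [h1, Pi.add_apply, h2, h3, map_add]
  | single n t =>
    rw [Finsupp.linearCombination_single]
    filter_upwards [Lp.coeFn_smul t (u n)] with ω h1
    rw [h1, Pi.smul_apply, Finsupp.linearCombination_single]

/-- Bounded gradients have convex combinations of tails that converge almost surely. -/
theorem exists_tailWeights_ae_tendsto {v : ℕ → Ω → C(Space N, ℝ)}
    (hl : ∀ n, IsLipschitzRandomFunction (v n)) (hs : ∀ n, HasStationaryIncrements P (v n))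
    {R : ℝ≥0} (hR : ∀ n, ∀ᵐ ω ∂P, ‖gradient (v n ω) 0‖ ≤ R) :
    ∃ (m : ℕ → ℕ) (c : ℕ → ℕ →₀ ℝ) (Φ : Ω → Space N), Tendsto m atTop atTop ∧
      (∀ k, c k ∈ tailWeights (m k)) ∧ Measurable Φ ∧
      ∀ᵐ ω ∂P, Tendsto (fun k => gradient (combination v (c k) ω) 0) atTop (𝓝 (Φ ω)) := by
  set u : ℕ → Lp (Space N) 2 P := fun n => (memLp_gradient_zero (P := P) (hl n) 2).toLp
  have hu : ∀ n, ∀ᵐ ω ∂P, u n ω = gradient (v n ω) 0 := fun n =>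
    (memLp_gradient_zero (P := P) (hl n) 2).coeFn_toLp
  have hub : ∀ n, ‖u n‖ ≤ R := fun n => by
    refine (Lp.norm_le_of_ae_bound (C := (R : ℝ)) R.2 ?_).trans_eq (by simp [measureUnivNNReal])
    filter_upwards [hu n, hR n] with ω h1 h2 using h1 ▸ h2
  obtain ⟨c, hc, y, hy⟩ := exists_tailWeights_tendsto hub
  -- Norm convergence gives convergence in measure, hence almost sure convergence along a
  -- subsequence `m`; the weights `c (m k)` are supported beyond `m k`.
  obtain ⟨m, hm, hmy⟩ := (tendstoInMeasure_of_tendsto_Lp hy).exists_seq_tendsto_ae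
  refine ⟨m, fun k => c (m k), y, hm.tendsto_atTop, fun k => hc _,
    (Lp.stronglyMeasurable y).measurable, ?_⟩
  filter_upwards [hmy, ae_all_iff.2 hu, ae_all_iff.2 fun k => coeFn_linearCombination u (c (m k)),
    ae_all_iff.2 fun k => ae_gradient_combination P hl hs (c (m k))] with ω h1 h2 h3 h4
  refine h1.congr fun k => ?_
  simp only [h3, h4, h2]

/-- Stability of admissible subsolutions, up to convex combinations and random constants. -/
theorem exists_admissibleSubsolution_limit (hH : IsStationaryHamiltonian H) {a : ℕ → ℝ}
    {v : ℕ → Ω → C(Space N, ℝ)} {a₀ : ℝ} (hv : ∀ n, v n ∈ admissibleSubsolutions P H (a n))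
    (ha : Tendsto a atTop (𝓝 a₀)) :
    ∃ v₀ ∈ admissibleSubsolutions P H a₀, ∃ (m : ℕ → ℕ) (c : ℕ → ℕ →₀ ℝ),
      Tendsto m atTop atTop ∧ (∀ k, c k ∈ tailWeights (m k)) ∧
      ∀ᵐ ω ∂P, Tendsto (fun k => center (combination v (c k) ω)) atTop (𝓝 (v₀ ω)) := by
  have hl := fun n => (hv n).1.lipschitz
  have hs := fun n => (hv n).1.stationaryIncrements
  obtain ⟨A, hA⟩ := ha.bddAbove_range
  obtain ⟨R, hR⟩ := hH.coercive A
  have hvR : ∀ n, ∀ᵐ ω ∂P, ‖gradient (v n ω) 0‖ ≤ R := fun n => by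
    filter_upwards [(isSubsolution_iff hH (hl n) (hs n)).1 (hv n).2] with ω hω
    exact hR ω 0 _ (hω.trans (hA ⟨n, rfl⟩))
  obtain ⟨m, c, Φ, hm, hc, hΦm, hΦ⟩ := exists_tailWeights_ae_tendsto hl hs hvR
  have hwl := fun k => isLipschitzRandomFunction_combination hl (c k)
  have hws := fun k => hasStationaryIncrements_combination hs (c k)
  have hwR : ∀ k, ∀ᵐ ω ∂P, ‖gradient (combination v (c k) ω) 0‖ ≤ R := fun k => by
    filter_upwards [ae_all_iff.2 hvR, ae_gradient_combination P hl hs (c k)] with ω h1 h2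
    exact h2 ▸ norm_linearCombination_le h1 (hc k)
  obtain ⟨v₀, hl₀, hs₀, hlim⟩ := exists_limit_randomFunction hwl hws hwR hΦ
  have hgrad := ae_gradient_limit_eq hwl hws hwR hΦm hΦ hl₀ hs₀ hlim
  refine ⟨v₀, ⟨⟨hl₀, hs₀, ?_⟩, ?_⟩, m, c, hm, hc, hlim⟩
  · rw [hasMeanZeroGradient_iff hs₀, integral_congr_ae hgrad]
    have h1 := tendsto_integral_of_dominated_convergence (μ := P) (fun _ => (R : ℝ))
      (fun k => (measurable_gradient_zero (hwl k).1).aestronglyMeasurable)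
      (integrable_const _) hwR hΦ
    simp_rw [integral_gradient_combination fun n => (hv n).1] at h1
    exact tendsto_nhds_unique h1 tendsto_const_nhds
  · rw [isSubsolution_iff hH hl₀ hs₀]
    -- For each slack `1 / (j + 1)` the tails eventually involve only levels below `a₀ + 1 / (j +
    -- 1)`; countably many slacks cost one null event.
    have h1 : ∀ j : ℕ, ∀ᵐ ω ∂P, H ω (0, Φ ω) ≤ a₀ + 1 / ((j : ℝ) + 1) := fun j => by
      obtain ⟨n₀, hn₀⟩ := eventually_atTop.1
        (ha.eventually_le_const (lt_add_of_pos_right a₀ (Nat.one_div_pos_of_nat (α := ℝ) (n := j))))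
      have h2 : ∀ k, ∀ᵐ ω ∂P, n₀ ≤ m k →
          H ω (0, gradient (combination v (c k) ω) 0) ≤ a₀ + 1 / ((j : ℝ) + 1) := fun k => by
        by_cases hk : n₀ ≤ m k
        · filter_upwards [ae_hamiltonian_combination_le hH hv (hc k)
            fun n hn => hn₀ n (hk.trans hn)] with ω hω _ using hω
        · exact Eventually.of_forall fun ω h => absurd h hk
      filter_upwards [ae_all_iff.2 h2, hΦ] with ω h3 h4
      have h5 : Continuous fun p : Space N => H ω (0, p) := by fun_prop
      exact le_of_tendsto ((h5.tendsto _).comp h4) ((hm.eventually_ge_atTop n₀).mono h3)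
    filter_upwards [ae_all_iff.2 h1, hgrad] with ω h2 h3
    rw [h3]
    refine ge_of_tendsto' (f := fun j : ℕ => a₀ + 1 / ((j : ℝ) + 1)) (x := atTop) ?_ h2
    simpa using (tendsto_one_div_add_atTop_nhds_zero_nat (𝕜 := ℝ)).const_add a₀

omit [MeasurableVAdd₂ (Space N) Ω] [IsProbabilityMeasure P]
  [VAddInvariantMeasure (Space N) Ω P] in
variable (P) in
theorem admissibleLevels_nonempty (hH : IsStationaryHamiltonian H) :
    (admissibleLevels P H).Nonempty := by
  obtain ⟨α, β, -, -, h⟩ := hH.growth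
  have hg : ∀ x : Space N, gradient ((0 : C(Space N, ℝ)) : Space N → ℝ) x = 0 := fun x =>
    gradient_fun_const x 0
  refine ⟨β 0, fun _ => 0, ⟨⟨measurable_const, 0, fun ω => LipschitzWith.const' 0⟩,
    fun z => by simp, fun x => by simp only [hg, integral_zero]⟩, ?_⟩
  refine Eventually.of_forall fun ω => Eventually.of_forall fun x => ⟨differentiableAt_const 0, ?_⟩
  rw [hg]
  simpa using (h x 0 ω).2

/-- An almost sure inequality under a probability measure holds at some `ω`, where the lower bound
of `H` applies. -/
theorem bddBelow_admissibleLevels (hH : IsStationaryHamiltonian H) :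
    BddBelow (admissibleLevels P H) := by
  obtain ⟨B, hB⟩ := hH.exists_lower_bound
  refine ⟨B, ?_⟩
  rintro a ⟨v, hv, hsub⟩
  obtain ⟨ω, hω⟩ := ((isSubsolution_iff hH hv.lipschitz hv.stationaryIncrements).1 hsub).exists
  exact (hB _ _ _).trans hω

theorem admissibleSubsolutions_criticalValue_nonempty (hH : IsStationaryHamiltonian H) :
    (admissibleSubsolutions P H (criticalValue P H)).Nonempty := by
  obtain ⟨a, -, ha, hmem⟩ :=
    exists_seq_tendsto_sInf (admissibleLevels_nonempty P hH) (bddBelow_admissibleLevels hH)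
  choose v hv using hmem
  obtain ⟨v₀, hv₀, -⟩ := exists_admissibleSubsolution_limit hH hv ha
  exact ⟨v₀, hv₀⟩

end Main

end StochasticHJ

theorem mainTheorem10 {N : ℕ} {Ω : Type*} [MeasurableSpace Ω]
    [AddAction (StochasticHJ.Space N) Ω] [MeasurableVAdd₂ (StochasticHJ.Space N) Ω]
    (P : Measure Ω) [IsProbabilityMeasure P] [ErgodicVAdd (StochasticHJ.Space N) Ω P]
    (H : Ω → C(StochasticHJ.Space N × StochasticHJ.Space N, ℝ))
    (hH : StochasticHJ.IsStationaryHamiltonian H) :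
    (∀ (a : ℕ → ℝ) (v : ℕ → Ω → C(StochasticHJ.Space N, ℝ)) (a₀ : ℝ),
      (∀ n, v n ∈ StochasticHJ.admissibleSubsolutions P H (a n)) →
      Tendsto a atTop (𝓝 a₀) →
      ∃ v₀ ∈ StochasticHJ.admissibleSubsolutions P H a₀,
      ∃ (m : ℕ → ℕ) (c : ℕ → ℕ →₀ ℝ) (g : ℕ → Ω → ℝ),
        Tendsto m atTop atTop ∧
        (∀ k, ∀ n ∈ (c k).support, m k ≤ n) ∧
        (∀ k n, 0 ≤ c k n) ∧
        (∀ k, ((c k).sum fun _ t => t) = 1) ∧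
        (∀ k, Measurable (g k)) ∧
        ∀ᵐ ω ∂P, ∀ K : Set (StochasticHJ.Space N), IsCompact K →
          TendstoUniformlyOn
            (fun k x => ((c k).sum fun n t => t * v n ω x) + g k ω) (v₀ ω) atTop K) ∧
    ((StochasticHJ.admissibleLevels P H).Nonempty ∧
      BddBelow (StochasticHJ.admissibleLevels P H) ∧
      (StochasticHJ.admissibleSubsolutions P H
        (StochasticHJ.criticalValue P H)).Nonempty) := by
  refine ⟨fun a v a₀ hv ha => ?_, StochasticHJ.admissibleLevels_nonempty P hH,
    StochasticHJ.bddBelow_admissibleLevels hH,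
    StochasticHJ.admissibleSubsolutions_criticalValue_nonempty hH⟩
  obtain ⟨v₀, hv₀, m, c, hm, hc, hlim⟩ :=
    StochasticHJ.exists_admissibleSubsolution_limit hH hv ha
  -- The random constant normalizes the combination to vanish at the origin.
  refine ⟨v₀, hv₀, m, c, fun k ω => -StochasticHJ.combination v (c k) ω 0, hm,
    fun k => (hc k).1, fun k => (hc k).2.1, fun k => (hc k).2.2, fun k => ?_, ?_⟩
  · have hw := (StochasticHJ.isLipschitzRandomFunction_combination
      (fun n => (hv n).1.lipschitz) (c k)).1
    let := StochasticHJ.borelContinuousMap (StochasticHJ.Space N)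
    exact (StochasticHJ.measurable_eval.comp (hw.prodMk measurable_const)).neg
  · filter_upwards [hlim] with ω hω
    rw [ContinuousMap.tendsto_iff_forall_isCompact_tendstoUniformlyOn] at hω
    intro K hK
    refine (hω K hK).congr (Eventually.of_forall fun k x _ => ?_)
    simp only [StochasticHJ.center_apply, ← StochasticHJ.combination_apply]
    ring
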